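/- Let $1<p<\infty$. Let $\mathbb{T}$ be the unit circle with normalized arc length measure, and let $H^p$ be the space of functions in $L^p(\mathbb{T})$ whose Fourier coefficients of negative index vanish, with the $L^p$ norm. Let $P_+$ be the Riesz projection of $L^p(\mathbb{T})$ onto $H^p$: for $f\in L^p(\mathbb{T})$, $P_+f$ is the function in $H^p$ with the same Fourier coefficients of index $n\ge 0$ as $f$. For $\psi\in L^\infty(\mathbb{T})$, let $T_\psi$ be the Toeplitz operator on $H^p$ defined by $T_\psi f=P_+(\psi f)$. Let $H^\infty$ be the space of bounded holomorphic functions in the unit disc, each identified with its boundary function in $L^\infty(\mathbb{T})$ given almost everywhere by radial limits. **Proposition 3.1.** For every $\varphi\in H^\infty$, the operator $T_{\bar\varphi}:H^p\to H^p$ is surjective if and only if $T_\varphi:H^p\to H^p$ is left invertible, that is, there is a bounded linear operator $L:H^p\to H^p$ with $L\,T_\varphi f=f$ for all $f\in H^p$. -/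

import Mathlib

open MeasureTheory Filter Topology
open scoped ENNReal Real

noncomputable section

namespace HardyToeplitz

instance factTwoPiPos : Fact (0 < 2 * π) := ⟨Real.two_pi_pos⟩

/-- The unit circle, parametrised by the angle `θ ∈ ℝ / 2πℤ`. -/
abbrev UCircle : Type := AddCircle (2 * π)

/-- Normalised arc length measure `dθ / 2π` on the circle. -/
abbrev arc : Measure UCircle := AddCircle.haarAddCircle

/-- The space `L^p(𝕋)`. -/
abbrev LpT (p : ℝ≥0∞) : Type := Lp ℂ p arc

lemma integrable_LpT {p : ℝ≥0∞} [hp : Fact (1 ≤ p)] (f : LpT p) : Integrable f arc :=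
  (Lp.memLp f).integrable hp.out

/-- The Hardy space `H^p`: the functions in `L^p(𝕋)` whose Fourier coefficients of negative index
vanish, with the norm of `L^p(𝕋)`. -/
def hardySpace (p : ℝ≥0∞) [Fact (1 ≤ p)] : Submodule ℂ (LpT p) where
  carrier := {f | ∀ n : ℤ, n < 0 → fourierCoeff (f : UCircle → ℂ) n = 0}
  zero_mem' := by
    intro n _
    rw [fourierCoeff_congr_ae (Lp.coeFn_zero ℂ p arc)]
    simp [fourierCoeff]
  add_mem' := by
    intro f g hf hg n hn
    rw [fourierCoeff_congr_ae (Lp.coeFn_add f g),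
      fourierCoeff.add (integrable_LpT f) (integrable_LpT g), Pi.add_apply, hf n hn, hg n hn,
      add_zero]
  smul_mem' := by
    intro c f hf n hn
    rw [fourierCoeff_congr_ae (Lp.coeFn_smul c f), fourierCoeff.const_smul, hf n hn, smul_zero]

/-- `b` is the boundary function of `F`: for almost every `θ`, the radial limit of `F` at
`e^{iθ}` exists and equals `b θ`. -/
def IsBoundaryFunction (F : ℂ → ℂ) (b : UCircle → ℂ) : Prop :=
  ∀ᵐ θ ∂arc, Tendsto (fun r : ℝ => F ((r : ℂ) * (AddCircle.toCircle θ : ℂ))) (𝓝[<] 1) (𝓝 (b θ))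

/-- The algebra `H^∞` of bounded holomorphic functions in the open unit disc, each identified with
its boundary function in `L^∞(𝕋)`. -/
def HInfty : Set (LpT ∞) :=
  {b | ∃ F : ℂ → ℂ, DifferentiableOn ℂ F (Metric.ball 0 1) ∧
    (∃ C : ℝ, ∀ z ∈ Metric.ball (0 : ℂ) 1, ‖F z‖ ≤ C) ∧ IsBoundaryFunction F b}

open scoped Classical in
/-- The Riesz projection `P₊ : L^p(𝕋) → H^p`, `1 < p < ∞`: it sends `f` to the unique `g ∈ H^p`
with the same Fourier coefficients of index `n ≥ 0` as `f`, so that `f - g` lies in the space of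
complex conjugates of functions of `H^p` that vanish at `0`. For `1 < p < ∞` such a `g` exists for
every `f` by the theorem of M. Riesz, so the value `0` in the second case is never taken there. -/
def rieszProjection {p : ℝ≥0∞} [Fact (1 ≤ p)] (f : LpT p) : hardySpace p :=
  if h : ∃ g : hardySpace p, ∀ n : ℤ, 0 ≤ n →
      fourierCoeff ((g : LpT p) : UCircle → ℂ) n = fourierCoeff (f : UCircle → ℂ) n
  then h.choose else 0

/-- The Toeplitz operator `T_ψ f = P₊ (ψ f)` on `H^p` with symbol `ψ ∈ L^∞(𝕋)`. -/
def toeplitz (p : ℝ≥0∞) [Fact (1 ≤ p)] (ψ : LpT ∞) (f : hardySpace p) : hardySpace p :=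
  rieszProjection ((ψ • (f : LpT p) : LpT p))

/-- Left invertibility in the algebra of bounded operators: `A` has a bounded linear left
inverse. -/
def IsLeftInvertible {X : Type*} [NormedAddCommGroup X] [NormedSpace ℂ X] (A : X → X) : Prop :=
  ∃ L : X →L[ℂ] X, ∀ x, L (A x) = x

end HardyToeplitz

end

namespace HardyToeplitz

/-! Both properties are equivalent to `φ` being invertible in `L^∞`, that is, to `|φ|` being bounded
below almost everywhere.

If `χ φ = 1`, then `T_χ` is a left inverse of `T_φ`, because `φ f` is already in `H^p`
(`isLeftInvertible_toeplitz`). With `ψ` the conjugate of `φ` and `χ ψ = 1`, `T_χ g` is a preimage of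
`g` under `T_ψ`, because multiplication by `ψ` never raises a frequency (`surjective_toeplitz`).

Conversely, each property yields an estimate `|∫ f g| ≤ K ‖f‖ ‖ψ g‖` on all of `L^p × L^q`, or with
the exponents exchanged. It passes from `H^p` to the whole space because unimodular characters shift
any trigonometric polynomial into the needed half-line of frequencies at no cost in norm. For left
invertibility it is Hölder's inequality plus boundedness below; for surjectivity it comes from the
open mapping theorem. Testing on the set where `|ψ|` is small shows that this set is null
(`exists_inverse_of_norm_pairL_le`).

All this requires `P₊` to be bounded, which is M. Riesz's theorem. For `1 < p ≤ 2` it follows by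
integrating a pointwise inequality on the right half-plane (`exists_abs_im_rpow_le`); for `p ≥ 2` it
follows by duality (`norm_analyticPart_le_of_dual`). -/

/-! ### Conjugate functions with positive real part, `1 < p ≤ 2` -/

/-- In polar form this is `1 ≤ A cos^p θ - B cos (p θ)` for `|θ| < π/2`. Near `±π/2` the second term
is enough, since there `p θ` lies strictly beyond `±π/2` and, as `p ≤ 2`, within `±π`; elsewhere
`cos θ` is bounded below and a large `A` absorbs everything. -/
theorem exists_abs_im_rpow_le {p : ℝ} (hp : 1 < p) (hp2 : p ≤ 2) :
    ∃ A B : ℝ, 0 ≤ A ∧ 0 ≤ B ∧ ∀ z : ℂ, 0 < z.re →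
      |z.im| ^ p ≤ A * z.re ^ p - B * (z ^ (p : ℂ)).re := by
  -- The angle `t` separates the two regimes; `t > π / (2p)` makes `cos (p t)` negative.
  obtain ⟨t, ht1, ht2⟩ : ∃ t : ℝ, π / (2 * p) < t ∧ t < π / 2 :=
    exists_between (by
      apply div_lt_div_of_pos_left Real.pi_pos (by norm_num) (by linarith))
  have hp0 : 0 < p := by linarith
  have hpt : π / 2 < p * t := by
    rw [div_lt_iff₀ (by positivity)] at ht1
    linarith
  have ht0 : 0 < t := lt_trans (by positivity) ht1
  have hptpi : p * t < π := by nlinarith [Real.pi_pos]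
  have hb : Real.cos (p * t) < 0 :=
    Real.cos_neg_of_pi_div_two_lt_of_lt hpt (by linarith [Real.pi_pos])
  have hct : 0 < Real.cos t := Real.cos_pos_of_mem_Ioo ⟨by linarith, ht2⟩
  have hctp : 0 < Real.cos t ^ p := Real.rpow_pos_of_pos hct p
  set B : ℝ := (-Real.cos (p * t))⁻¹ with hB
  have hB0 : 0 < B := inv_pos.2 (by linarith)
  have key : ∀ θ : ℝ, 0 ≤ θ → θ < π / 2 →
      1 ≤ (1 + B) / Real.cos t ^ p * Real.cos θ ^ p - B * Real.cos (p * θ) := by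
    intro θ h0 h1
    have hc : 0 < Real.cos θ := Real.cos_pos_of_mem_Ioo ⟨by linarith, h1⟩
    rcases le_total t θ with h | h
    · have h2 : Real.cos (p * θ) ≤ Real.cos (p * t) :=
        Real.cos_le_cos_of_nonneg_of_le_pi (by positivity) (by nlinarith [Real.pi_pos])
          (by nlinarith)
      have h3 : B * (-Real.cos (p * t)) = 1 := inv_mul_cancel₀ (by linarith)
      have h4 : 0 ≤ (1 + B) / Real.cos t ^ p * Real.cos θ ^ p := by positivity
      nlinarith
    · have h2 : Real.cos t ^ p ≤ Real.cos θ ^ p :=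
        Real.rpow_le_rpow hct.le
          (Real.cos_le_cos_of_nonneg_of_le_pi h0 (by linarith [Real.pi_pos]) h) hp0.le
      have h3 : 1 + B ≤ (1 + B) / Real.cos t ^ p * Real.cos θ ^ p := by
        rw [div_mul_eq_mul_div, le_div_iff₀ hctp]
        exact mul_le_mul_of_nonneg_left h2 (by positivity)
      nlinarith [Real.cos_le_one (p * θ)]
  refine ⟨(1 + B) / Real.cos t ^ p, B, by positivity, hB0.le, fun z hz => ?_⟩
  have hz0 : z ≠ 0 := by rintro rfl; simp at hz
  have hr : 0 < ‖z‖ := norm_pos_iff.2 hz0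
  have harg : |z.arg| < π / 2 := Complex.abs_arg_lt_pi_div_two_iff.2 (Or.inl hz)
  have h1 := key |z.arg| (abs_nonneg _) harg
  have hre : z.re = ‖z‖ * Real.cos |z.arg| := by
    rw [Real.cos_abs, Complex.norm_mul_cos_arg]
  have hcos : 0 < Real.cos |z.arg| :=
    Real.cos_pos_of_mem_Ioo ⟨by linarith [abs_nonneg z.arg, Real.pi_pos], harg⟩
  have hpow : (z ^ (p : ℂ)).re = ‖z‖ ^ p * Real.cos (p * |z.arg|) := by
    rw [Complex.cpow_ofReal_re, mul_comm p]
    congr 1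
    rw [← Real.cos_abs (z.arg * p), abs_mul, abs_of_pos hp0]
  have him : |z.im| ^ p ≤ ‖z‖ ^ p :=
    Real.rpow_le_rpow (abs_nonneg _) (Complex.abs_im_le_norm z) hp0.le
  have hrp : 0 < ‖z‖ ^ p := Real.rpow_pos_of_pos hr p
  rw [hpow, hre, Real.mul_rpow hr.le hcos.le]
  nlinarith

/-- The minimum principle for `Re W`, obtained from the maximum modulus principle for `exp (-W)`. -/
theorem re_pos_of_le_re_on_sphere {W : Polynomial ℂ} {δ : ℝ} (hδ : 0 < δ)
    (h : ∀ z : ℂ, ‖z‖ = 1 → δ ≤ (W.eval z).re) {z : ℂ} (hz : ‖z‖ ≤ 1) : 0 < (W.eval z).re := by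
  have hd : Differentiable ℂ fun z => Complex.exp (-(W.eval z)) :=
    (W.differentiable.neg).cexp
  have h1 : ‖Complex.exp (-(W.eval z))‖ ≤ Real.exp (-δ) := by
    refine Complex.norm_le_of_forall_mem_frontier_norm_le (U := Metric.ball (0 : ℂ) 1)
      Metric.isBounded_ball hd.diffContOnCl (fun w hw => ?_) ?_
    · rw [frontier_ball _ one_ne_zero, mem_sphere_zero_iff_norm] at hw
      rw [Complex.norm_exp, Complex.neg_re]
      exact Real.exp_le_exp.2 (neg_le_neg (h w hw))
    · rw [closure_ball _ one_ne_zero]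
      simpa using hz
  rw [Complex.norm_exp, Complex.neg_re, Real.exp_le_exp] at h1
  linarith

theorem integral_comp_toCircle {f : ℂ → ℂ} (hf : DiffContOnCl ℂ f (Metric.ball 0 1)) :
    ∫ θ, f (AddCircle.toCircle θ : ℂ) ∂arc = f 0 := by
  have h := DiffContOnCl.circleAverage (c := 0) (R := 1) (f := f) (by simpa using hf)
  rw [← h, Real.circleAverage_def, AddCircle.integral_haarAddCircle]
  rw [← AddCircle.intervalIntegral_preimage (2 * π) 0]
  simp only [zero_add, circleMap_zero, Complex.ofReal_one, one_mul, AddCircle.toCircle_apply_mk]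
  congr 1
  apply intervalIntegral.integral_congr
  intro t _
  simp only [Circle.coe_exp]
  congr 2
  push_cast
  field_simp

/-- The trace of a polynomial on the circle. -/
noncomputable def polyTrace (W : Polynomial ℂ) : C(UCircle, ℂ) where
  toFun θ := W.eval (AddCircle.toCircle θ : ℂ)
  continuous_toFun := by fun_prop

@[simp] theorem polyTrace_apply (W : Polynomial ℂ) (θ : UCircle) :
    polyTrace W θ = W.eval (AddCircle.toCircle θ : ℂ) := rfl

/-- The real part of a continuous function on the circle. -/
noncomputable def rePart (f : C(UCircle, ℂ)) : C(UCircle, ℝ) := ⟨fun θ => (f θ).re, by fun_prop⟩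

/-- The imaginary part of a continuous function on the circle. -/
noncomputable def imPart (f : C(UCircle, ℂ)) : C(UCircle, ℝ) := ⟨fun θ => (f θ).im, by fun_prop⟩

@[simp] theorem rePart_apply (f : C(UCircle, ℂ)) (θ : UCircle) : rePart f θ = (f θ).re := rfl
@[simp] theorem imPart_apply (f : C(UCircle, ℂ)) (θ : UCircle) : imPart f θ = (f θ).im := rfl

theorem integrable_of_continuous {E : Type*} [NormedAddCommGroup E] {f : UCircle → E}
    (hf : Continuous f) : Integrable f arc :=
  hf.integrable_of_hasCompactSupport (HasCompactSupport.of_compactSpace f)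

/-- Since `Re W > 0` on the closed disc, `W ^ p` is holomorphic and its mean is `W(0) ^ p`. As
`W(0)` is a positive real, the `B` term has a favourable sign and can be dropped. -/
theorem integral_abs_im_rpow_le {p A B : ℝ} (hp : 0 < p) (hB : 0 ≤ B)
    (hAB : ∀ z : ℂ, 0 < z.re → |z.im| ^ p ≤ A * z.re ^ p - B * (z ^ (p : ℂ)).re)
    {W : Polynomial ℂ} {δ : ℝ} (hδ : 0 < δ) (hre : ∀ z : ℂ, ‖z‖ = 1 → δ ≤ (W.eval z).re)
    (h0 : (W.eval 0).im = 0) :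
    ∫ θ, |imPart (polyTrace W) θ| ^ p ∂arc ≤ A * ∫ θ, |rePart (polyTrace W) θ| ^ p ∂arc := by
  have hpos := fun z hz => re_pos_of_le_re_on_sphere hδ hre (z := z) hz
  have hcont : ∀ z : ℂ, ‖z‖ ≤ 1 → DifferentiableAt ℂ (fun z => (W.eval z) ^ (p : ℂ)) z :=
    fun z hz => W.differentiable.differentiableAt.cpow_const (Or.inl (hpos z hz))
  have hdiff : DiffContOnCl ℂ (fun z => (W.eval z) ^ (p : ℂ)) (Metric.ball 0 1) := by
    apply DifferentiableOn.diffContOnCl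
    rw [closure_ball _ one_ne_zero]
    exact fun z hz => (hcont z (by simpa using hz)).differentiableWithinAt
  have hmean := integral_comp_toCircle hdiff
  have hpc : Continuous fun θ : UCircle => (W.eval (AddCircle.toCircle θ : ℂ)) ^ (p : ℂ) := by
    rw [continuous_iff_continuousAt]
    intro θ
    have h1 := (hcont (AddCircle.toCircle θ : ℂ) (Circle.norm_coe _).le).continuousAt
    have h2 : Continuous fun θ : UCircle => (AddCircle.toCircle θ : ℂ) := by fun_prop
    exact ContinuousAt.comp (f := fun θ : UCircle => (AddCircle.toCircle θ : ℂ)) h1 h2.continuousAt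
  have hW0 : 0 ≤ ((W.eval 0) ^ (p : ℂ)).re := by
    have : W.eval 0 = ((W.eval 0).re : ℂ) := by apply Complex.ext <;> simp [h0]
    rw [this, ← Complex.ofReal_cpow (hpos 0 (by simp)).le, Complex.ofReal_re]
    exact Real.rpow_nonneg (hpos 0 (by simp)).le p
  have hre' : ∫ θ : UCircle, ((W.eval (AddCircle.toCircle θ : ℂ)) ^ (p : ℂ)).re ∂arc =
      ((W.eval 0) ^ (p : ℂ)).re := by
    rw [← hmean]
    exact integral_re (integrable_of_continuous hpc)
  have hi1 : Integrable (fun θ => |imPart (polyTrace W) θ| ^ p) arc :=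
    integrable_of_continuous (((imPart (polyTrace W)).continuous.abs).rpow_const
      fun _ => Or.inr hp.le)
  have hi2 : Integrable (fun θ => |rePart (polyTrace W) θ| ^ p) arc :=
    integrable_of_continuous (((rePart (polyTrace W)).continuous.abs).rpow_const
      fun _ => Or.inr hp.le)
  have hi3 : Integrable
      (fun θ : UCircle => ((W.eval (AddCircle.toCircle θ : ℂ)) ^ (p : ℂ)).re) arc :=
    (integrable_of_continuous hpc).re
  calc ∫ θ, |imPart (polyTrace W) θ| ^ p ∂arc
      ≤ ∫ θ, (A * |rePart (polyTrace W) θ| ^ p -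
          B * ((W.eval (AddCircle.toCircle θ : ℂ)) ^ (p : ℂ)).re) ∂arc := by
        refine integral_mono hi1 ((hi2.const_mul A).sub (hi3.const_mul B)) fun θ => ?_
        have h1 : 0 < (W.eval (AddCircle.toCircle θ : ℂ)).re := hpos _ (Circle.norm_coe _).le
        have := hAB _ h1
        simpa [abs_of_pos h1] using this
    _ = A * ∫ θ, |rePart (polyTrace W) θ| ^ p ∂arc - B * ((W.eval 0) ^ (p : ℂ)).re := by
        rw [integral_sub (hi2.const_mul A) (hi3.const_mul B), integral_const_mul,
          integral_const_mul, hre']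
    _ ≤ _ := by nlinarith [mul_nonneg hB hW0]

theorem toLp_norm_eq_integral_rpow {E : Type*} [NormedAddCommGroup E] [NormedSpace ℝ E]
    [SecondCountableTopologyEither UCircle E]
    {p : ℝ≥0∞} [Fact (1 ≤ p)] (hp : p ≠ ⊤) (f : C(UCircle, E)) :
    ‖ContinuousMap.toLp p arc ℝ f‖ = (∫ θ, ‖f θ‖ ^ p.toReal ∂arc) ^ (p.toReal)⁻¹ := by
  have h0 : p ≠ 0 := (zero_lt_one.trans_le Fact.out).ne'
  rw [Lp.norm_def, eLpNorm_congr_ae (ContinuousMap.coeFn_toLp arc f),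
    MemLp.eLpNorm_eq_integral_rpow_norm h0 hp (f.memLp arc ℝ),
    ENNReal.toReal_ofReal]
  positivity

theorem toLp_norm_mono {E F : Type*} [NormedAddCommGroup E] [NormedSpace ℝ E]
    [SecondCountableTopologyEither UCircle E] [NormedAddCommGroup F] [NormedSpace ℝ F]
    [SecondCountableTopologyEither UCircle F]
    {p : ℝ≥0∞} [Fact (1 ≤ p)] {f : C(UCircle, E)} {g : C(UCircle, F)}
    (h : ∀ θ, ‖f θ‖ ≤ ‖g θ‖) :
    ‖ContinuousMap.toLp p arc ℝ f‖ ≤ ‖ContinuousMap.toLp p arc ℝ g‖ := by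
  apply Lp.norm_le_norm_of_ae_le
  filter_upwards [ContinuousMap.coeFn_toLp (p := p) (𝕜 := ℝ) arc f,
    ContinuousMap.coeFn_toLp (p := p) (𝕜 := ℝ) arc g] with θ h1 h2
  rw [h1, h2]
  exact h θ

theorem toLp_norm_le_sup {E : Type*} [NormedAddCommGroup E] [NormedSpace ℝ E]
    [SecondCountableTopologyEither UCircle E]
    {p : ℝ≥0∞} [Fact (1 ≤ p)] {f : C(UCircle, E)} {c : ℝ} (hc : 0 ≤ c) (h : ∀ θ, ‖f θ‖ ≤ c) :
    ‖ContinuousMap.toLp p arc ℝ f‖ ≤ c := by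
  refine (Lp.norm_le_of_ae_bound hc (C := c) ?_).trans ?_
  · filter_upwards [ContinuousMap.coeFn_toLp (p := p) (𝕜 := ℝ) arc f] with θ h1
    rw [h1]
    exact h θ
  · have h1 : measureUnivNNReal arc = 1 := by
      simp [measureUnivNNReal]
    simp [h1]

theorem exists_norm_imPart_le_of_pos {p : ℝ≥0∞} [Fact (1 ≤ p)] (hp : 1 < p) (hp2 : p ≤ 2) :
    ∃ K : ℝ, 0 ≤ K ∧ ∀ (W : Polynomial ℂ) (δ : ℝ), 0 < δ →
      (∀ z : ℂ, ‖z‖ = 1 → δ ≤ (W.eval z).re) → (W.eval 0).im = 0 →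
      ‖ContinuousMap.toLp p arc ℝ (imPart (polyTrace W))‖ ≤
        K * ‖ContinuousMap.toLp p arc ℝ (rePart (polyTrace W))‖ := by
  have htop : p ≠ ⊤ := (hp2.trans_lt (by simp)).ne
  have h1 : 1 < p.toReal := by
    rw [← ENNReal.toReal_one]; exact (ENNReal.toReal_lt_toReal (by simp) htop).2 hp
  have h2 : p.toReal ≤ 2 := by
    simpa using (ENNReal.toReal_le_toReal htop (by simp)).2 hp2
  obtain ⟨A, B, hA, hB, hAB⟩ := exists_abs_im_rpow_le h1 h2
  refine ⟨A ^ (p.toReal)⁻¹, Real.rpow_nonneg hA _, fun W δ hδ hre h0 => ?_⟩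
  rw [toLp_norm_eq_integral_rpow htop, toLp_norm_eq_integral_rpow htop,
    ← Real.mul_rpow hA (integral_nonneg fun θ => by positivity)]
  refine Real.rpow_le_rpow (integral_nonneg fun θ => by positivity) ?_ (by positivity)
  exact integral_abs_im_rpow_le (by linarith) hB hAB hδ hre h0

/-! ### Trigonometric polynomials and the conjugate function bound -/

/-- The trigonometric polynomial with given coefficients. -/
noncomputable def trigPoly : (ℤ →₀ ℂ) →ₗ[ℂ] C(UCircle, ℂ) :=
  Finsupp.linearCombination ℂ fourier

/-- The analytic part of the trigonometric polynomial with given coefficients. -/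
noncomputable def analyticPart : (ℤ →₀ ℂ) →ₗ[ℂ] C(UCircle, ℂ) :=
  Finsupp.linearCombination ℂ fun n => if 0 ≤ n then fourier n else 0

@[simp] theorem trigPoly_single (n : ℤ) (a : ℂ) :
    trigPoly (Finsupp.single n a) = a • fourier n := by
  simp [trigPoly]

@[simp] theorem analyticPart_single (n : ℤ) (a : ℂ) :
    analyticPart (Finsupp.single n a) = if 0 ≤ n then a • fourier n else 0 := by
  simp only [analyticPart, Finsupp.linearCombination_single]
  split_ifs <;> simp

theorem range_trigPoly :
    LinearMap.range trigPoly = Submodule.span ℂ (Set.range (fourier (T := 2 * π))) :=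
  Finsupp.range_linearCombination ℂ

theorem denseRange_trigPoly : DenseRange trigPoly := by
  have h := span_fourier_closure_eq_top (T := 2 * π)
  rw [← range_trigPoly, ← Submodule.dense_iff_topologicalClosure_eq_top] at h
  exact h

theorem denseRange_toLp_trigPoly {p : ℝ≥0∞} [Fact (1 ≤ p)] (hp : p ≠ ⊤) :
    DenseRange fun c => ContinuousMap.toLp p arc ℂ (trigPoly c) :=
  (ContinuousMap.toLp_denseRange ℂ arc ℂ hp).comp denseRange_trigPoly
    (ContinuousMap.toLp p arc ℂ).continuous

/-- Conjugating the terms of negative frequency leaves the real part unchanged and produces a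
polynomial. Doing this for `f` and for `-i f` gives `Q₁` and `Q₂`; in `Q₁ + i Q₂` the conjugated
terms cancel and the analytic ones double. Bounds for polynomials in terms of their real parts thus
control the analytic part. -/
theorem exists_poly_re_im (c : ℤ →₀ ℂ) : ∃ Q₁ Q₂ : Polynomial ℂ,
    rePart (polyTrace Q₁) = rePart (trigPoly c) ∧ rePart (polyTrace Q₂) = imPart (trigPoly c) ∧
    polyTrace Q₁ + Complex.I • polyTrace Q₂ = (2 : ℂ) • analyticPart c ∧
    Q₁.eval 0 = c 0 ∧ Q₂.eval 0 = -Complex.I * c 0 := by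
  induction c using Finsupp.induction_linear with
  | zero =>
    refine ⟨0, 0, ?_, ?_, ?_, ?_, ?_⟩
    · ext; simp
    · ext; simp
    · ext; simp
    · simp
    · simp
  | add c d hc hd =>
    obtain ⟨Q₁, Q₂, h1, h2, h3, h4, h5⟩ := hc
    obtain ⟨R₁, R₂, k1, k2, k3, k4, k5⟩ := hd
    refine ⟨Q₁ + R₁, Q₂ + R₂, ?_, ?_, ?_, ?_, ?_⟩
    · ext θ
      have a1 := DFunLike.congr_fun h1 θ
      have a2 := DFunLike.congr_fun k1 θ
      simp only [rePart_apply, polyTrace_apply] at a1 a2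
      simp [a1, a2]
    · ext θ
      have a1 := DFunLike.congr_fun h2 θ
      have a2 := DFunLike.congr_fun k2 θ
      simp only [rePart_apply, imPart_apply, polyTrace_apply] at a1 a2
      simp [a1, a2]
    · rw [map_add, smul_add, ← h3, ← k3]
      ext θ
      simp only [ContinuousMap.add_apply, ContinuousMap.smul_apply, polyTrace_apply,
        Polynomial.eval_add, smul_eq_mul]
      ring
    · simp [h4, k4]
    · simp [h5, k5]; ring
  | single n a =>
    have hz : ∀ θ : UCircle, ∀ n : ℕ,
        fourier (n : ℤ) θ = (AddCircle.toCircle θ : ℂ) ^ n := fun θ n => by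
      rw [fourier_apply, natCast_zsmul, AddCircle.toCircle_nsmul, Circle.coe_pow]
    rcases le_or_gt 0 n with hn | hn
    · lift n to ℕ using hn
      refine ⟨Polynomial.monomial n a, Polynomial.monomial n (-Complex.I * a), ?_, ?_, ?_, ?_, ?_⟩
      · ext θ; simp [hz]
      · ext θ; simp [hz]
      · ext θ
        simp only [ContinuousMap.add_apply, ContinuousMap.smul_apply, polyTrace_apply,
          Polynomial.eval_monomial, analyticPart_single, if_pos (Int.natCast_nonneg n),
          smul_eq_mul, hz]
        linear_combination (-a * (AddCircle.toCircle θ : ℂ) ^ n) * Complex.I_mul_I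
      · rcases eq_or_ne n 0 with rfl | h <;> simp [*]
      · rcases eq_or_ne n 0 with rfl | h <;> simp [*]
    · obtain ⟨m, rfl⟩ : ∃ m : ℕ, n = -(m : ℤ) := ⟨n.natAbs, by omega⟩
      have hm : m ≠ 0 := by omega
      refine ⟨Polynomial.monomial m (star a), Polynomial.monomial m (Complex.I * star a),
        ?_, ?_, ?_, ?_, ?_⟩
      · ext θ
        have h1 : fourier (-(m : ℤ)) θ = star ((AddCircle.toCircle θ : ℂ) ^ m) := by
          rw [fourier_neg, hz]; rfl
        simp only [rePart_apply, trigPoly_single, ContinuousMap.smul_apply, h1]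
        simp [-map_pow, -star_pow]
      · ext θ
        have h1 : fourier (-(m : ℤ)) θ = star ((AddCircle.toCircle θ : ℂ) ^ m) := by
          rw [fourier_neg, hz]; rfl
        simp only [rePart_apply, imPart_apply, trigPoly_single, ContinuousMap.smul_apply, h1]
        simp [-map_pow, -star_pow]
        ring
      · ext θ
        have : ¬ (0 : ℤ) ≤ -(m : ℤ) := by omega
        simp only [ContinuousMap.add_apply, ContinuousMap.smul_apply, polyTrace_apply,
          Polynomial.eval_monomial, analyticPart_single, if_neg this, smul_zero,
          ContinuousMap.zero_apply, smul_eq_mul]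
        linear_combination (star a * (AddCircle.toCircle θ : ℂ) ^ m) * Complex.I_mul_I
      · simp [hm]
      · simp [hm]

theorem exists_poly_re_close (u : C(UCircle, ℝ)) {ε : ℝ} (hε : 0 < ε) :
    ∃ W : Polynomial ℂ, (W.eval 0).im = 0 ∧ ∀ θ, |rePart (polyTrace W) θ - u θ| ≤ ε := by
  obtain ⟨c, hc⟩ := denseRange_trigPoly.exists_dist_lt
    (⟨fun θ => (u θ : ℂ), by fun_prop⟩ : C(UCircle, ℂ)) hε
  obtain ⟨Q, -, h1, -⟩ := exists_poly_re_im c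
  refine ⟨Q - Polynomial.C ((Q.eval 0).im * Complex.I), by simp, fun θ => ?_⟩
  have h2 : rePart (polyTrace (Q - Polynomial.C ((Q.eval 0).im * Complex.I))) θ =
      rePart (trigPoly c) θ := by
    rw [← h1]; simp
  rw [h2]
  have h3 := (ContinuousMap.dist_lt_iff hε).1 hc θ
  rw [dist_comm, Complex.dist_eq] at h3
  have h4 := Complex.abs_re_le_norm (trigPoly c θ - (u θ : ℂ))
  simp only [Complex.sub_re, Complex.ofReal_re] at h4
  exact h4.trans h3.le

/-- The sign condition is removed by splitting the real part `u` into positive and negative parts.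
These are not real parts of polynomials, so they are approximated uniformly after a small upward
shift. -/
theorem exists_norm_imPart_le {p : ℝ≥0∞} [Fact (1 ≤ p)] (hp : 1 < p) (hp2 : p ≤ 2) :
    ∃ K : ℝ, 0 ≤ K ∧ ∀ Q : Polynomial ℂ, (Q.eval 0).im = 0 →
      ‖ContinuousMap.toLp p arc ℝ (imPart (polyTrace Q))‖ ≤
        K * ‖ContinuousMap.toLp p arc ℝ (rePart (polyTrace Q))‖ := by
  obtain ⟨K, hK, h⟩ := exists_norm_imPart_le_of_pos hp hp2
  refine ⟨2 * K, by positivity, fun Q hQ => ?_⟩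
  set u := rePart (polyTrace Q) with hu
  have key : ∀ ε : ℝ, 0 < ε → ‖ContinuousMap.toLp p arc ℝ (imPart (polyTrace Q))‖ ≤
      2 * K * ‖ContinuousMap.toLp p arc ℝ u‖ + ε * (6 * K) := by
    intro ε hε
    let v : C(UCircle, ℝ) := ⟨fun θ => max (u θ) 0, by fun_prop⟩
    -- The shift `2ε` exceeds the error `ε`, so both `Re W ≈ u⁺ + 2ε` and `Re (W - Q) ≈ u⁻ + 2ε`
    -- stay at least `ε`.
    obtain ⟨W, hW0, hW⟩ := exists_poly_re_close (v + ContinuousMap.const _ (2 * ε)) hε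
    have hw : ∀ θ, |rePart (polyTrace W) θ - (max (u θ) 0 + 2 * ε)| ≤ ε := hW
    have hsph : ∀ z : ℂ, ‖z‖ = 1 → ∃ θ : UCircle, (AddCircle.toCircle θ : ℂ) = z := by
      intro z hz
      obtain ⟨θ, hθ⟩ := (AddCircle.homeomorphCircle (T := 2 * π) Real.two_pi_pos.ne').surjective
        ⟨z, by simpa [Submonoid.unitSphere] using hz⟩
      refine ⟨θ, ?_⟩
      rw [AddCircle.homeomorphCircle_apply] at hθ
      rw [hθ]
    have b1 : ∀ θ, ε ≤ rePart (polyTrace W) θ ∧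
        rePart (polyTrace W) θ ≤ max (u θ) 0 + 3 * ε := fun θ => by
      have := abs_le.1 (hw θ)
      have := le_max_right (u θ) 0
      constructor <;> linarith
    have b2 : ∀ θ, ε ≤ rePart (polyTrace (W - Q)) θ ∧
        rePart (polyTrace (W - Q)) θ ≤ |u θ| + 3 * ε := fun θ => by
      have h1 : rePart (polyTrace (W - Q)) θ = rePart (polyTrace W) θ - u θ := by simp [hu]
      rw [h1]
      have := abs_le.1 (hw θ)
      have := le_max_left (u θ) 0
      refine ⟨by linarith, ?_⟩
      rcases le_total (u θ) 0 with h0 | h0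
      · rw [max_eq_right h0] at *
        rw [abs_of_nonpos h0]; linarith
      · rw [max_eq_left h0] at *
        rw [abs_of_nonneg h0]; linarith
    have n0 : ∀ f : C(UCircle, ℝ), (∀ θ, 0 ≤ f θ ∧ f θ ≤ |u θ| + 3 * ε) →
        ‖ContinuousMap.toLp p arc ℝ f‖ ≤ ‖ContinuousMap.toLp p arc ℝ u‖ + 3 * ε := by
      intro f hf
      let a : C(UCircle, ℝ) := ⟨fun θ => |u θ|, by fun_prop⟩
      calc ‖ContinuousMap.toLp p arc ℝ f‖
          ≤ ‖ContinuousMap.toLp p arc ℝ (a + ContinuousMap.const _ (3 * ε))‖ := by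
            refine toLp_norm_mono fun θ => ?_
            simp only [ContinuousMap.add_apply, ContinuousMap.coe_mk, ContinuousMap.const_apply, a]
            rw [Real.norm_of_nonneg (hf θ).1, Real.norm_of_nonneg (by positivity)]
            exact (hf θ).2
        _ ≤ ‖ContinuousMap.toLp p arc ℝ a‖ +
            ‖ContinuousMap.toLp p arc ℝ (ContinuousMap.const UCircle (3 * ε))‖ := by
            rw [map_add]; exact norm_add_le _ _
        _ ≤ _ := add_le_add (toLp_norm_mono fun θ => by simp [a])
            (toLp_norm_le_sup (by positivity) fun θ => by
              simp [abs_of_pos hε])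
    have h1 := h W ε hε (fun z hz => by
      obtain ⟨θ, rfl⟩ := hsph z hz
      exact (b1 θ).1) hW0
    have h2 := h (W - Q) ε hε (fun z hz => by
      obtain ⟨θ, rfl⟩ := hsph z hz
      exact (b2 θ).1) (by simp [hW0, hQ])
    have h3 := n0 (rePart (polyTrace W)) fun θ => ⟨by linarith [(b1 θ).1],
      (b1 θ).2.trans (by
        have : max (u θ) 0 ≤ |u θ| := max_le (le_abs_self _) (abs_nonneg _)
        linarith)⟩
    have h4 := n0 (rePart (polyTrace (W - Q))) fun θ => ⟨by linarith [(b2 θ).1], (b2 θ).2⟩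
    have h5 : imPart (polyTrace Q) = imPart (polyTrace W) - imPart (polyTrace (W - Q)) := by
      ext θ; simp
    have h6 := norm_sub_le (ContinuousMap.toLp p arc ℝ (imPart (polyTrace W)))
      (ContinuousMap.toLp p arc ℝ (imPart (polyTrace (W - Q))))
    rw [h5, map_sub]
    nlinarith
  refine le_of_forall_pos_le_add fun η hη => ?_
  -- The `+ 1` guards against `K = 0`.
  refine (key (η / (6 * K + 1)) (by positivity)).trans ?_
  gcongr
  rw [div_mul_eq_mul_div, div_le_iff₀ (by positivity)]
  nlinarith

/-! ### Fourier coefficients, the duality pairing and M. Riesz's theorem -/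

/-- The `n`-th Fourier coefficient as a bounded functional on `L^p(𝕋)`. -/
noncomputable def coeffL (p : ℝ≥0∞) [Fact (1 ≤ p)] (n : ℤ) : LpT p →L[ℂ] ℂ :=
  LinearMap.mkContinuous
    { toFun := fun f => fourierCoeff (f : UCircle → ℂ) n
      map_add' := fun f g => by
        rw [fourierCoeff_congr_ae (Lp.coeFn_add f g),
          fourierCoeff.add (integrable_LpT f) (integrable_LpT g), Pi.add_apply]
      map_smul' := fun c f => by
        rw [fourierCoeff_congr_ae (Lp.coeFn_smul c f), fourierCoeff.const_smul]
        rfl } 1 <| by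
    intro f
    rw [one_mul]
    change ‖∫ θ, fourier (-n) θ • f θ ∂arc‖ ≤ _
    calc ‖∫ θ, fourier (-n) θ • f θ ∂arc‖ ≤ ∫ θ, ‖fourier (-n) θ • f θ‖ ∂arc :=
          norm_integral_le_integral_norm _
      _ = ∫ θ, ‖f θ‖ ∂arc := by
          congr 1; ext θ
          rw [norm_smul, fourier_apply, Circle.norm_coe, one_mul]
      _ = (eLpNorm f 1 arc).toReal := by
          rw [eLpNorm_one_eq_lintegral_enorm,
            integral_norm_eq_lintegral_enorm (Lp.aestronglyMeasurable f)]
      _ ≤ ‖f‖ := by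
          rw [Lp.norm_def]
          exact ENNReal.toReal_mono (Lp.eLpNorm_ne_top f)
            (eLpNorm_le_eLpNorm_of_exponent_le Fact.out (Lp.aestronglyMeasurable f))

theorem coeffL_apply {p : ℝ≥0∞} [Fact (1 ≤ p)] (n : ℤ) (f : LpT p) :
    coeffL p n f = fourierCoeff (f : UCircle → ℂ) n := rfl

theorem norm_coeffL_apply_le {p : ℝ≥0∞} [Fact (1 ≤ p)] (n : ℤ) (f : LpT p) :
    ‖coeffL p n f‖ ≤ ‖f‖ := by
  refine (ContinuousLinearMap.le_of_opNorm_le _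
    (LinearMap.mkContinuous_norm_le _ zero_le_one _) f).trans ?_
  rw [one_mul]

/-- The class in `L^p(𝕋)` of a continuous function. -/
noncomputable abbrev toLpT (p : ℝ≥0∞) [Fact (1 ≤ p)] : C(UCircle, ℂ) →L[ℂ] LpT p :=
  ContinuousMap.toLp p arc ℂ

theorem coeFn_toLpT {p : ℝ≥0∞} [Fact (1 ≤ p)] (f : C(UCircle, ℂ)) : toLpT p f =ᵐ[arc] f :=
  ContinuousMap.coeFn_toLp arc f

theorem coeffL_toLpT {p : ℝ≥0∞} [Fact (1 ≤ p)] (n : ℤ) (f : C(UCircle, ℂ)) :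
    coeffL p n (toLpT p f) = ∫ θ, fourier (-n) θ * f θ ∂arc := by
  rw [coeffL_apply, fourierCoeff_congr_ae (coeFn_toLpT f)]
  rfl

theorem coeffL_fourier {p : ℝ≥0∞} [Fact (1 ≤ p)] (n m : ℤ) :
    coeffL p n (toLpT p (fourier m)) = if m = n then 1 else 0 := by
  rw [coeffL_apply, fourierCoeff_congr_ae (coeFn_toLpT _), fourierCoeff_fourier, Pi.single_apply]
  simp [eq_comm]

theorem coeffL_trigPoly {p : ℝ≥0∞} [Fact (1 ≤ p)] (n : ℤ) (c : ℤ →₀ ℂ) :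
    coeffL p n (toLpT p (trigPoly c)) = c n := by
  induction c using Finsupp.induction_linear with
  | zero => simp
  | add c d hc hd => simp only [map_add, hc, hd, Finsupp.add_apply]
  | single m a =>
    rw [trigPoly_single, map_smul, map_smul, coeffL_fourier, Finsupp.single_apply]
    simp

theorem coeffL_analyticPart {p : ℝ≥0∞} [Fact (1 ≤ p)] (n : ℤ) (c : ℤ →₀ ℂ) :
    coeffL p n (toLpT p (analyticPart c)) = if 0 ≤ n then c n else 0 := by
  induction c using Finsupp.induction_linear with
  | zero => simp
  | add c d hc hd =>
    simp only [map_add, hc, hd, Finsupp.add_apply]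
    split_ifs <;> simp
  | single m a =>
    rw [analyticPart_single, Finsupp.single_apply]
    by_cases hm : 0 ≤ m
    · rw [if_pos hm, map_smul, map_smul, coeffL_fourier]
      by_cases h : m = n
      · subst h; simp [hm]
      · simp [h]
    · rw [if_neg hm]
      by_cases h : m = n
      · subst h; simp [hm]
      · simp [h]

/-- The bilinear pairing `(f, g) ↦ ∫ f g` of `L^p(𝕋)` and `L^q(𝕋)`. -/
noncomputable def pairL (p q : ℝ≥0∞) [Fact (1 ≤ p)] [Fact (1 ≤ q)]
    [ENNReal.HolderConjugate p q] : LpT p →L[ℂ] LpT q →L[ℂ] ℂ :=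
  (ContinuousLinearMap.mul ℂ ℂ).lpPairing arc p q

section Pairing

variable {p q : ℝ≥0∞} [Fact (1 ≤ p)] [Fact (1 ≤ q)] [ENNReal.HolderConjugate p q]

theorem pairL_apply (f : LpT p) (g : LpT q) : pairL p q f g = ∫ θ, f θ * g θ ∂arc :=
  ContinuousLinearMap.lpPairing_eq_integral _ f g

theorem norm_pairL_le (f : LpT p) (g : LpT q) : ‖pairL p q f g‖ ≤ ‖f‖ * ‖g‖ := by
  have h1 : pairL p q f g = L1.integral (f • g : Lp ℂ 1 arc) := by
    rw [pairL_apply, L1.integral_eq_integral]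
    refine integral_congr_ae ?_
    filter_upwards [Lp.coeFn_lpSMul (r := 1) f g] with θ h
    rw [h]; rfl
  rw [h1]
  exact (L1.norm_integral_le _).trans (Lp.norm_smul_le f g)

theorem pairL_toLpT (f g : C(UCircle, ℂ)) :
    pairL p q (toLpT p f) (toLpT q g) = ∫ θ, f θ * g θ ∂arc := by
  rw [pairL_apply]
  refine integral_congr_ae ?_
  filter_upwards [coeFn_toLpT (p := p) f, coeFn_toLpT (p := q) g] with θ h1 h2
  rw [h1, h2]

theorem pairL_star_fourier (f : C(UCircle, ℂ)) (n : ℤ) (a : ℂ) :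
    pairL p q (toLpT p f) (toLpT q (star (a • fourier n))) =
      star a * coeffL p n (toLpT p f) := by
  rw [pairL_toLpT, coeffL_toLpT, ← integral_const_mul]
  congr 1
  ext θ
  rw [fourier_neg]
  simp only [ContinuousMap.star_apply, ContinuousMap.smul_apply, smul_eq_mul, star_mul]
  change _ * (star _ * _) = star a * (star _ * _)
  ring

/-- Self-adjointness of the analytic projection, which transfers its bound from `L^q` to `L^p`. -/
theorem pairL_analyticPart_star_trigPoly (c d : ℤ →₀ ℂ) :
    pairL p q (toLpT p (analyticPart c)) (toLpT q (star (trigPoly d))) =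
      pairL p q (toLpT p (trigPoly c)) (toLpT q (star (analyticPart d))) := by
  induction d using Finsupp.induction_linear with
  | zero => simp
  | add d e hd he => simp only [map_add, star_add, hd, he]
  | single n a =>
    rw [trigPoly_single, pairL_star_fourier, analyticPart_single, coeffL_analyticPart]
    split_ifs with h
    · rw [pairL_star_fourier, coeffL_trigPoly]
    · simp

theorem norm_toLpT_star (f : C(UCircle, ℂ)) : ‖toLpT p (star f)‖ = ‖toLpT p f‖ :=
  le_antisymm (toLp_norm_mono (p := p) fun θ => by simp)
    (toLp_norm_mono (p := p) fun θ => by simp)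

theorem denseRange_star_trigPoly (hq : q ≠ ⊤) :
    DenseRange fun d => toLpT q (star (trigPoly d)) :=
  (ContinuousMap.toLp_denseRange ℂ arc ℂ hq).comp
    ((star_involutive.surjective.denseRange).comp denseRange_trigPoly continuous_star)
    (toLpT q).continuous

theorem norm_toLpT_eq (hp : p ≠ ⊤) (f : C(UCircle, ℂ)) :
    ‖toLpT p f‖ = (∫ θ, ‖f θ‖ ^ p.toReal ∂arc) ^ (p.toReal)⁻¹ :=
  toLp_norm_eq_integral_rpow hp f

/-- Self-adjointness bounds the pairing of `u = analyticPart c` with every element of `L^q`; the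
extremal element for Hölder's inequality then recovers the norm of `u`. -/
theorem norm_analyticPart_le_of_dual (hp : p ≠ ⊤) (hp2 : 2 ≤ p) (hq : q ≠ ⊤) {C : ℝ}
    (h : ∀ d, ‖toLpT q (analyticPart d)‖ ≤ C * ‖toLpT q (trigPoly d)‖) (c : ℤ →₀ ℂ) :
    ‖toLpT p (analyticPart c)‖ ≤ C * ‖toLpT p (trigPoly c)‖ := by
  have hpr : 2 ≤ p.toReal := by
    simpa using (ENNReal.toReal_le_toReal (by simp) hp).2 hp2
  have hconj : p.toReal.HolderConjugate q.toReal := by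
    have := ENNReal.HolderConjugate.inv_add_inv_eq_one p q
    rw [Real.holderConjugate_iff]
    refine ⟨by linarith, ?_⟩
    have h2 := congrArg ENNReal.toReal this
    rwa [ENNReal.toReal_add, ENNReal.toReal_inv, ENNReal.toReal_inv, ENNReal.toReal_one] at h2
    · simpa using (zero_lt_one.trans_le (Fact.out : 1 ≤ p)).ne'
    · simpa using (zero_lt_one.trans_le (Fact.out : 1 ≤ q)).ne'
  have h1 : ∀ g : LpT q, ‖pairL p q (toLpT p (analyticPart c)) g‖ ≤
      C * ‖toLpT p (trigPoly c)‖ * ‖g‖ := by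
    intro g
    refine (denseRange_star_trigPoly hq).induction_on g (isClosed_le (by fun_prop) (by fun_prop))
      fun d => ?_
    rw [pairL_analyticPart_star_trigPoly, norm_toLpT_star]
    refine (norm_pairL_le _ _).trans ?_
    rw [norm_toLpT_star]
    calc _ ≤ ‖toLpT p (trigPoly c)‖ * (C * ‖toLpT q (trigPoly d)‖) := by gcongr; exact h d
      _ = _ := by ring
  set u := analyticPart c with hu
  -- The extremal function `|u|^(p-2) ū` is continuous because `p ≥ 2`.
  let G : C(UCircle, ℂ) := ⟨fun θ => ((‖u θ‖ ^ (p.toReal - 2) : ℝ) : ℂ) * star (u θ), by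
    refine Continuous.mul (Complex.continuous_ofReal.comp ?_) (by fun_prop)
    exact u.continuous.norm.rpow_const fun _ => Or.inr (by linarith)⟩
  have hG : ∀ θ, ‖G θ‖ = ‖u θ‖ ^ (p.toReal - 1) := fun θ => by
    simp only [G, ContinuousMap.coe_mk, norm_mul, norm_star, Complex.norm_real]
    rw [Real.norm_of_nonneg (by positivity)]
    rcases eq_or_ne (‖u θ‖) 0 with h0 | h0
    · rw [h0, mul_zero, Real.zero_rpow (by linarith)]
    · rw [← Real.rpow_add_one h0]; ring_nf
  set I := ∫ θ, ‖u θ‖ ^ p.toReal ∂arc with hI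
  have hI0 : 0 ≤ I := integral_nonneg fun θ => by positivity
  have h2 : pairL p q (toLpT p u) (toLpT q G) = (I : ℂ) := by
    rw [pairL_toLpT, hI, ← integral_complex_ofReal]
    congr 1
    ext θ
    have : ‖u θ‖ ^ p.toReal = ‖u θ‖ ^ (p.toReal - 2) * (‖u θ‖ ^ 2) := by
      rcases eq_or_ne (‖u θ‖) 0 with h0 | h0
      · rw [h0, Real.zero_rpow (by linarith)]; simp
      · rw [← Real.rpow_add_natCast h0]; norm_num
    rw [this]
    simp only [G, ContinuousMap.coe_mk, Complex.ofReal_mul, Complex.ofReal_pow]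
    rw [← Complex.mul_conj']
    change _ * (_ * star _) = _ * (_ * star _)
    ring
  have h3 : ‖toLpT q G‖ = I ^ (q.toReal)⁻¹ := by
    rw [norm_toLpT_eq hq, hI]
    congr 2
    ext θ
    rw [hG, ← Real.rpow_mul (norm_nonneg _), hconj.sub_one_mul_conj]
  have h4 := h1 (toLpT q G)
  rw [h2, h3, Complex.norm_real, Real.norm_of_nonneg hI0] at h4
  rw [norm_toLpT_eq hp u, ← hI]
  rcases hI0.eq_or_lt with h0 | h0
  · rw [← h0, Real.zero_rpow (inv_ne_zero (by linarith))]
    rcases (norm_nonneg (toLpT p (trigPoly c))).eq_or_lt with h5 | h5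
    · rw [← h5, mul_zero]
    · refine mul_nonneg ?_ h5.le
      -- When `u` vanishes, only `0 ≤ C` remains to be shown; the constant function `1` gives it,
      -- being its own analytic part.
      have h6 := h (Finsupp.single 0 1)
      have h7 : 0 < ‖toLpT q (fourier 0)‖ := by
        refine lt_of_lt_of_le one_pos (le_trans (le_of_eq ?_) (norm_coeffL_apply_le 0 _))
        rw [coeffL_fourier]; simp
      simp only [trigPoly_single, analyticPart_single, le_refl, if_true, one_smul] at h6
      nlinarith
  · have h5 : I = I ^ (p.toReal)⁻¹ * I ^ (q.toReal)⁻¹ := by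
      rw [← Real.rpow_add h0, hconj.inv_add_inv_eq_one, Real.rpow_one]
    have h6 : 0 < I ^ (q.toReal)⁻¹ := Real.rpow_pos_of_pos h0 _
    exact le_of_mul_le_mul_right (h5 ▸ h4) h6

end Pairing

theorem norm_polyTrace_le {p : ℝ≥0∞} [Fact (1 ≤ p)] (Q : Polynomial ℂ) :
    ‖toLpT p (polyTrace Q)‖ ≤ ‖ContinuousMap.toLp p arc ℝ (rePart (polyTrace Q))‖ +
      ‖ContinuousMap.toLp p arc ℝ (imPart (polyTrace Q))‖ := by
  let a : C(UCircle, ℝ) := ⟨fun θ => |rePart (polyTrace Q) θ|, by fun_prop⟩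
  let b : C(UCircle, ℝ) := ⟨fun θ => |imPart (polyTrace Q) θ|, by fun_prop⟩
  calc ‖toLpT p (polyTrace Q)‖ ≤ ‖ContinuousMap.toLp p arc ℝ (a + b)‖ := by
        refine toLp_norm_mono (p := p) fun θ => ?_
        simp only [a, b, ContinuousMap.add_apply, ContinuousMap.coe_mk]
        rw [Real.norm_of_nonneg (by positivity)]
        exact Complex.norm_le_abs_re_add_abs_im _
    _ ≤ ‖ContinuousMap.toLp p arc ℝ a‖ + ‖ContinuousMap.toLp p arc ℝ b‖ := by
        rw [map_add]; exact norm_add_le _ _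
    _ ≤ _ := add_le_add (toLp_norm_mono fun θ => by simp [a]) (toLp_norm_mono fun θ => by simp [b])

theorem exists_norm_analyticPart_le_of_le_two {p : ℝ≥0∞} [Fact (1 ≤ p)] (hp : 1 < p)
    (hp2 : p ≤ 2) :
    ∃ C : ℝ, ∀ c, ‖toLpT p (analyticPart c)‖ ≤ C * ‖toLpT p (trigPoly c)‖ := by
  obtain ⟨K, hK, hKQ⟩ := exists_norm_imPart_le hp hp2
  have hpoly : ∀ Q : Polynomial ℂ, ‖toLpT p (polyTrace Q)‖ ≤
      (1 + K) * ‖ContinuousMap.toLp p arc ℝ (rePart (polyTrace Q))‖ + ‖Q.eval 0‖ := by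
    intro Q
    set R := Q - Polynomial.C ((Q.eval 0).im * Complex.I) with hR
    have h1 := hKQ R (by simp [hR])
    have h2 : rePart (polyTrace R) = rePart (polyTrace Q) := by ext θ; simp [hR]
    have h3 : imPart (polyTrace Q) =
        imPart (polyTrace R) + ContinuousMap.const _ (Q.eval 0).im := by ext θ; simp [hR]
    have h4 : ‖ContinuousMap.toLp p arc ℝ (ContinuousMap.const UCircle (Q.eval 0).im)‖ ≤
        ‖Q.eval 0‖ := toLp_norm_le_sup (norm_nonneg _) fun θ => Complex.abs_im_le_norm _
    have h5 := norm_polyTrace_le (p := p) Q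
    have h6 := norm_add_le (ContinuousMap.toLp p arc ℝ (imPart (polyTrace R)))
      (ContinuousMap.toLp p arc ℝ (ContinuousMap.const UCircle (Q.eval 0).im))
    rw [← map_add, ← h3] at h6
    rw [h2] at h1
    linarith
  refine ⟨2 + K, fun c => ?_⟩
  obtain ⟨Q₁, Q₂, h1, h2, h3, h4, h5⟩ := exists_poly_re_im c
  have k1 := hpoly Q₁
  have k2 := hpoly Q₂
  rw [h1, h4] at k1
  rw [h2, h5, norm_mul, norm_neg, Complex.norm_I, one_mul] at k2
  have k3 : ‖c 0‖ ≤ ‖toLpT p (trigPoly c)‖ := by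
    rw [← coeffL_trigPoly (p := p) 0 c]; exact norm_coeffL_apply_le 0 _
  have k4 : ‖ContinuousMap.toLp p arc ℝ (rePart (trigPoly c))‖ ≤ ‖toLpT p (trigPoly c)‖ :=
    toLp_norm_mono (p := p) fun θ => Complex.abs_re_le_norm _
  have k5 : ‖ContinuousMap.toLp p arc ℝ (imPart (trigPoly c))‖ ≤ ‖toLpT p (trigPoly c)‖ :=
    toLp_norm_mono (p := p) fun θ => Complex.abs_im_le_norm _
  have k6 : 2 * ‖toLpT p (analyticPart c)‖ ≤
      ‖toLpT p (polyTrace Q₁)‖ + ‖toLpT p (polyTrace Q₂)‖ := by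
    have := congrArg (toLpT p) h3
    rw [map_add, map_smul, map_smul] at this
    calc 2 * ‖toLpT p (analyticPart c)‖ = ‖(2 : ℂ) • toLpT p (analyticPart c)‖ := by
          rw [norm_smul]; simp
      _ ≤ _ := by
          rw [← this]
          refine (norm_add_le _ _).trans ?_
          rw [norm_smul, Complex.norm_I, one_mul]
  -- Each of `Q₁`, `Q₂` contributes at most `(1 + K) + 1` times the norm; halving the sum gives `2 +
  -- K`.
  nlinarith

/-- **M. Riesz's theorem** for trigonometric polynomials. -/
theorem exists_norm_analyticPart_le {p : ℝ≥0∞} [Fact (1 ≤ p)] (hp : 1 < p) (hp' : p ≠ ⊤) :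
    ∃ C : ℝ, ∀ c, ‖toLpT p (analyticPart c)‖ ≤ C * ‖toLpT p (trigPoly c)‖ := by
  rcases le_total p 2 with h | h
  · exact exists_norm_analyticPart_le_of_le_two hp h
  · have hq : p.HolderConjugate (ENNReal.conjExponent p) := inferInstance
    have : Fact (1 ≤ ENNReal.conjExponent p) := ⟨ENNReal.HolderConjugate.one_le _ p⟩
    have hq1 : 1 < ENNReal.conjExponent p :=
      (ENNReal.HolderConjugate.lt_top_iff_one_lt p _).1 hp'.lt_top
    have hq2 : ENNReal.conjExponent p ≠ ⊤ :=
      (ENNReal.HolderConjugate.ne_top_iff_ne_one _ p).2 hp.ne'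
    have hq3 : ENNReal.conjExponent p ≤ 2 := by
      have h1 := ENNReal.HolderConjugate.inv_add_inv_eq_one p (ENNReal.conjExponent p)
      by_contra! h2
      have h3 : (ENNReal.conjExponent p)⁻¹ < 2⁻¹ := ENNReal.inv_lt_inv.2 h2
      have h4 : p⁻¹ ≤ 2⁻¹ := ENNReal.inv_le_inv.2 h
      have h5 := ENNReal.add_lt_add_of_le_of_lt (by simp; positivity) h4 h3
      rw [h1, ENNReal.inv_two_add_inv_two] at h5
      exact lt_irrefl _ h5
    obtain ⟨C, hC⟩ := exists_norm_analyticPart_le_of_le_two hq1 hq3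
    exact ⟨C, norm_analyticPart_le_of_dual hp' h hq2 hC⟩

/-! ### Multiplication operators and invertibility of symbols -/

/-- Multiplication by an `L^∞` function as a bounded operator on `L^p(𝕋)`. -/
noncomputable def mulL (p : ℝ≥0∞) [Fact (1 ≤ p)] (ψ : LpT ⊤) : LpT p →L[ℂ] LpT p :=
  LinearMap.mkContinuous
    { toFun := fun f => (ψ • f : LpT p)
      map_add' := fun f g => Lp.add_smul ψ f g
      map_smul' := fun c f => (Lp.smul_comm c ψ f).symm } ‖ψ‖ (Lp.norm_smul_le ψ)

/-- The bounded extension of the analytic part to `L^p(𝕋)`. -/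
noncomputable def rieszL (p : ℝ≥0∞) [Fact (1 ≤ p)] : LpT p →L[ℂ] LpT p :=
  LinearMap.extendOfNorm ((toLpT p).toLinearMap ∘ₗ analyticPart)
    ((toLpT p).toLinearMap ∘ₗ trigPoly)

section Multiplication

variable {p : ℝ≥0∞} [Fact (1 ≤ p)]

theorem coeFn_mulL (ψ : LpT ⊤) (f : LpT p) : mulL p ψ f =ᵐ[arc] fun θ => ψ θ * f θ :=
  Lp.coeFn_lpSMul (r := p) ψ f

theorem mulL_comm (ψ χ : LpT ⊤) (f : LpT p) : mulL p ψ (mulL p χ f) = mulL p χ (mulL p ψ f) := by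
  apply Lp.ext
  filter_upwards [coeFn_mulL ψ (mulL p χ f), coeFn_mulL χ (mulL p ψ f), coeFn_mulL ψ f,
    coeFn_mulL χ f] with θ h1 h2 h3 h4
  rw [h1, h2, h3, h4]
  ring

theorem mulL_mulL_of_mul_eq_one {ψ χ : LpT ⊤} (h : ∀ᵐ θ ∂arc, χ θ * ψ θ = 1) (f : LpT p) :
    mulL p χ (mulL p ψ f) = f := by
  apply Lp.ext
  filter_upwards [coeFn_mulL χ (mulL p ψ f), coeFn_mulL ψ f, h] with θ h1 h2 h3
  rw [h1, h2, ← mul_assoc, h3, one_mul]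

theorem norm_mulL_fourier (n : ℤ) (f : LpT p) : ‖mulL p (toLpT ⊤ (fourier n)) f‖ = ‖f‖ := by
  rw [Lp.norm_def, Lp.norm_def]
  congr 1
  apply eLpNorm_congr_norm_ae
  filter_upwards [coeFn_mulL (toLpT ⊤ (fourier n)) f, coeFn_toLpT (p := ⊤) (fourier n)]
    with θ h1 h2
  rw [h1, h2, norm_mul, fourier_apply, Circle.norm_coe, one_mul]

theorem coeffL_mulL_fourier (n m : ℤ) (f : LpT p) :
    coeffL p n (mulL p (toLpT ⊤ (fourier m)) f) = coeffL p (n - m) f := by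
  refine integral_congr_ae ?_
  filter_upwards [coeFn_mulL (toLpT ⊤ (fourier m)) f, coeFn_toLpT (p := ⊤) (fourier m)]
    with θ h1 h2
  rw [h1, h2, smul_eq_mul, smul_eq_mul, ← mul_assoc, ← fourier_add]
  congr 3
  ring

theorem coeffL_mulL_toLpT_fourier (ψ : LpT ⊤) (n m : ℤ) :
    coeffL p n (mulL p ψ (toLpT p (fourier m))) = coeffL ⊤ (n - m) ψ := by
  refine integral_congr_ae ?_
  filter_upwards [coeFn_mulL ψ (toLpT p (fourier m)), coeFn_toLpT (p := p) (fourier m)]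
    with θ h1 h2
  rw [h1, h2, smul_eq_mul, smul_eq_mul, mul_left_comm, ← fourier_add, mul_comm]
  congr 3
  ring

theorem coeffL_star (ψ : LpT p) (n : ℤ) : coeffL p n (star ψ) = star (coeffL p (-n) ψ) := by
  rw [coeffL_apply, coeffL_apply, fourierCoeff, fourierCoeff]
  refine Eq.trans ?_ integral_conj
  refine integral_congr_ae ?_
  filter_upwards [Lp.coeFn_star ψ] with θ h
  rw [h, smul_eq_mul, smul_eq_mul, map_mul, ← fourier_neg, neg_neg]
  rfl

end Multiplication

section Pairing

variable {p q : ℝ≥0∞} [Fact (1 ≤ p)] [Fact (1 ≤ q)] [ENNReal.HolderConjugate p q]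

theorem pairL_mulL (ψ : LpT ⊤) (f : LpT p) (g : LpT q) :
    pairL p q (mulL p ψ f) g = pairL p q f (mulL q ψ g) := by
  rw [pairL_apply, pairL_apply]
  refine integral_congr_ae ?_
  filter_upwards [coeFn_mulL ψ f, coeFn_mulL ψ g] with θ h1 h2
  rw [h1, h2]
  ring

theorem pairL_fourier (f : LpT p) (n : ℤ) :
    pairL p q f (toLpT q (fourier n)) = coeffL p (-n) f := by
  rw [pairL_apply]
  refine integral_congr_ae ?_
  filter_upwards [coeFn_toLpT (p := q) (fourier n)] with θ h
  rw [h, neg_neg, smul_eq_mul, mul_comm]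

theorem pairL_trigPoly_congr {f g : LpT p} {d : ℤ →₀ ℂ}
    (h : ∀ n ∈ d.support, coeffL p (-n) f = coeffL p (-n) g) :
    pairL p q f (toLpT q (trigPoly d)) = pairL p q g (toLpT q (trigPoly d)) := by
  rw [trigPoly, Finsupp.linearCombination_apply, Finsupp.sum]
  simp only [map_sum, map_smul, pairL_fourier]
  exact Finset.sum_congr rfl fun n hn => by rw [h n hn]

/-- Trigonometric polynomials are dense in `L^q`, as `q < ∞` when `p > 1`; so the coefficients
determine all pairings, in particular those with indicators, which are integrals over measurable
sets. -/
theorem ext_coeffL (hp : 1 < p) {f g : LpT p} (h : ∀ n, coeffL p n f = coeffL p n g) : f = g := by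
  have : Fact (1 ≤ ENNReal.conjExponent p) := ⟨ENNReal.HolderConjugate.one_le _ p⟩
  have hq : ENNReal.conjExponent p ≠ ⊤ :=
    (ENNReal.HolderConjugate.ne_top_iff_ne_one _ p).2 hp.ne'
  have h1 : ∀ k : LpT (ENNReal.conjExponent p), pairL p _ f k = pairL p _ g k := fun k => by
    refine (denseRange_toLp_trigPoly hq).induction_on k
      (isClosed_eq (by fun_prop) (by fun_prop)) fun d => ?_
    exact pairL_trigPoly_congr fun n _ => h _
  refine Lp.ext ?_
  refine (integrable_LpT f).ae_eq_of_forall_setIntegral_eq _ _ (integrable_LpT g) ?_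
  intro s hs _
  have h2 : ∀ u : LpT p, pairL p (ENNReal.conjExponent p) u
      (indicatorConstLp _ hs (measure_ne_top arc s) (1 : ℂ)) = ∫ θ in s, u θ ∂arc := fun u => by
    rw [pairL_apply, ← integral_indicator hs]
    refine integral_congr_ae ?_
    filter_upwards [indicatorConstLp_coeFn (p := ENNReal.conjExponent p) (hs := hs)
      (hμs := measure_ne_top arc s) (c := (1 : ℂ))] with θ h
    rw [h]
    by_cases hθ : θ ∈ s <;> simp [hθ]
  rw [← h2, ← h2, h1]

/-- Taking for both `f` and `g` the indicator of `E = {|ψ| < δ}` gives `|E| ≤ |K| δ |E|`, because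
`1/p + 1/q = 1`. With `|K| δ < 1` this makes `E` null, and `1/ψ` is bounded by `1/δ`. -/
theorem exists_inverse_of_norm_pairL_le (hp : p ≠ ⊤) (hq : q ≠ ⊤) {ψ : LpT ⊤} {K : ℝ}
    (h : ∀ (f : LpT p) (g : LpT q), ‖pairL p q f g‖ ≤ K * ‖f‖ * ‖mulL q ψ g‖) :
    ∃ χ : LpT ⊤, ∀ᵐ θ ∂arc, χ θ * ψ θ = 1 := by
  set δ : ℝ := (|K| + 1)⁻¹ with hδ
  have hδ0 : 0 < δ := by positivity
  have hmeas : Measurable (ψ : UCircle → ℂ) := (Lp.stronglyMeasurable ψ).measurable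
  set E : Set UCircle := {θ | ‖ψ θ‖ < δ} with hE
  have hEm : MeasurableSet E := measurableSet_lt hmeas.norm measurable_const
  have hE0 : arc E = 0 := by
    set f : LpT p := indicatorConstLp p hEm (measure_ne_top arc E) (1 : ℂ) with hf
    set g : LpT q := indicatorConstLp q hEm (measure_ne_top arc E) (1 : ℂ) with hg
    have hfae : f =ᵐ[arc] E.indicator fun _ => (1 : ℂ) := indicatorConstLp_coeFn
    have hgae : g =ᵐ[arc] E.indicator fun _ => (1 : ℂ) := indicatorConstLp_coeFn
    have h1 : pairL p q f g = (arc.real E : ℂ) := by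
      rw [pairL_apply]
      have : ∫ θ, f θ * g θ ∂arc = ∫ θ, E.indicator (fun _ => (1 : ℂ)) θ ∂arc := by
        refine integral_congr_ae ?_
        filter_upwards [hfae, hgae] with θ h1 h2
        rw [h1, h2]
        by_cases hθ : θ ∈ E <;> simp [hθ]
      rw [this, integral_indicator hEm]
      simp
    have h2 : ‖mulL q ψ g‖ ≤ δ * ‖g‖ := by
      refine Lp.norm_le_mul_norm_of_ae_le_mul ?_
      filter_upwards [coeFn_mulL ψ g, hgae] with θ h1 h2
      rw [h1, h2]
      by_cases hθ : θ ∈ E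
      · simpa [hθ] using le_of_lt hθ
      · simp [hθ]
    have h3 : ‖f‖ * ‖g‖ = arc.real E := by
      rw [hf, hg, norm_indicatorConstLp (zero_lt_one.trans_le Fact.out).ne' hp,
        norm_indicatorConstLp (zero_lt_one.trans_le Fact.out).ne' hq, norm_one, one_mul, one_mul]
      rcases (measureReal_nonneg (μ := arc) (s := E)).eq_or_lt with h0 | h0
      · rw [← h0, Real.zero_rpow, zero_mul]
        exact one_div_ne_zero (ENNReal.toReal_pos (zero_lt_one.trans_le Fact.out).ne' hp).ne'
      · rw [← Real.rpow_add h0]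
        have h4 := congrArg ENNReal.toReal (ENNReal.HolderConjugate.inv_add_inv_eq_one p q)
        rw [ENNReal.toReal_add, ENNReal.toReal_inv, ENNReal.toReal_inv, ENNReal.toReal_one] at h4
        · rw [one_div, one_div, h4, Real.rpow_one]
        · simpa using (zero_lt_one.trans_le (Fact.out : 1 ≤ p)).ne'
        · simpa using (zero_lt_one.trans_le (Fact.out : 1 ≤ q)).ne'
    have h4 := h f g
    rw [h1, Complex.norm_real, Real.norm_of_nonneg measureReal_nonneg] at h4
    have h5 : arc.real E ≤ |K| * δ * arc.real E := by
      calc arc.real E ≤ K * ‖f‖ * ‖mulL q ψ g‖ := h4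
        _ ≤ |K| * ‖f‖ * (δ * ‖g‖) := by gcongr; exact le_abs_self K
        _ = |K| * δ * (‖f‖ * ‖g‖) := by ring
        _ = _ := by rw [h3]
    have h6 : |K| * δ < 1 := by
      rw [hδ, ← div_eq_mul_inv, div_lt_one (by positivity)]
      linarith
    have h7 : arc.real E = 0 := by nlinarith [measureReal_nonneg (μ := arc) (s := E)]
    exact (measureReal_eq_zero_iff (measure_ne_top arc E)).1 h7
  have hae : ∀ᵐ θ ∂arc, δ ≤ ‖ψ θ‖ := by
    rw [ae_iff]
    simpa [hE] using hE0
  have hmem : MemLp (fun θ => (ψ θ)⁻¹) ⊤ arc := by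
    refine memLp_top_of_bound hmeas.inv.aestronglyMeasurable δ⁻¹ ?_
    filter_upwards [hae] with θ h
    rw [norm_inv]
    exact inv_anti₀ hδ0 h
  refine ⟨hmem.toLp, ?_⟩
  filter_upwards [hmem.coeFn_toLp, hae] with θ h1 h2
  rw [h1]
  exact inv_mul_cancel₀ (norm_pos_iff.1 (hδ0.trans_le h2))

end Pairing

/-! ### The Riesz projection on `L^p` and analytic multipliers -/

section Riesz

variable {p : ℝ≥0∞} [Fact (1 ≤ p)] (hp : 1 < p) (hp' : p ≠ ⊤)

include hp hp'

theorem rieszL_trigPoly (c : ℤ →₀ ℂ) :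
    rieszL p (toLpT p (trigPoly c)) = toLpT p (analyticPart c) :=
  LinearMap.extendOfNorm_eq (f := (toLpT p).toLinearMap ∘ₗ analyticPart)
    (e := (toLpT p).toLinearMap ∘ₗ trigPoly) (denseRange_toLp_trigPoly hp')
    (exists_norm_analyticPart_le hp hp') c

theorem coeffL_rieszL (n : ℤ) (f : LpT p) :
    coeffL p n (rieszL p f) = if 0 ≤ n then coeffL p n f else 0 := by
  refine (denseRange_toLp_trigPoly hp').induction_on f (isClosed_eq (by fun_prop) ?_) fun c => ?_
  · split_ifs <;> fun_prop
  · rw [rieszL_trigPoly hp hp', coeffL_analyticPart, coeffL_trigPoly]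

theorem rieszL_mem (f : LpT p) : rieszL p f ∈ hardySpace p := fun n hn => by
  rw [← coeffL_apply, coeffL_rieszL hp hp', if_neg (not_le.2 hn)]

theorem rieszL_of_mem {f : LpT p} (hf : f ∈ hardySpace p) : rieszL p f = f := by
  refine ext_coeffL hp fun n => ?_
  rw [coeffL_rieszL hp hp']
  split_ifs with h
  · rfl
  · exact (hf n (not_le.1 h)).symm

theorem coe_rieszProjection (f : LpT p) :
    ((rieszProjection f : hardySpace p) : LpT p) = rieszL p f := by
  have h : ∃ g : hardySpace p, ∀ n : ℤ, 0 ≤ n →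
      fourierCoeff ((g : LpT p) : UCircle → ℂ) n = fourierCoeff (f : UCircle → ℂ) n :=
    ⟨⟨rieszL p f, rieszL_mem hp hp' f⟩, fun n hn => by
      rw [← coeffL_apply, coeffL_rieszL hp hp', if_pos hn, coeffL_apply]⟩
  rw [rieszProjection, dif_pos h]
  refine ext_coeffL hp fun n => ?_
  rw [coeffL_rieszL hp hp']
  split_ifs with hn
  · exact h.choose_spec n hn
  · exact h.choose.2 n (not_le.1 hn)

theorem coe_toeplitz (ψ : LpT ⊤) (f : hardySpace p) :
    (toeplitz p ψ f : LpT p) = rieszL p (mulL p ψ f) :=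
  coe_rieszProjection hp hp' _

theorem mulL_mem_hardySpace {φ : LpT ⊤} (hφ : ∀ n < 0, coeffL ⊤ n φ = 0) {f : LpT p}
    (hf : f ∈ hardySpace p) : mulL p φ f ∈ hardySpace p := by
  intro n hn
  -- Writing `f` as its own projection turns the claim into a closed condition on all of `L^p`, so
  -- that density of trigonometric polynomials applies.
  rw [← coeffL_apply, ← rieszL_of_mem hp hp' hf]
  refine (denseRange_toLp_trigPoly hp').induction_on f
    (isClosed_eq (by fun_prop) (by fun_prop)) fun c => ?_
  rw [rieszL_trigPoly hp hp', analyticPart, Finsupp.linearCombination_apply, Finsupp.sum]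
  simp only [map_sum, map_smul]
  refine Finset.sum_eq_zero fun m _ => ?_
  split_ifs with hm
  · rw [coeffL_mulL_toLpT_fourier, hφ _ (by omega), smul_zero]
  · simp

/-- A symbol without positive frequencies keeps negative frequencies negative, so discarding them
before multiplying changes nothing after projection. -/
theorem rieszL_mulL_rieszL {ψ : LpT ⊤} (hψ : ∀ n, 0 < n → coeffL ⊤ n ψ = 0) (f : LpT p) :
    rieszL p (mulL p ψ (rieszL p f)) = rieszL p (mulL p ψ f) := by
  refine ext_coeffL hp fun n => ?_
  rw [coeffL_rieszL hp hp', coeffL_rieszL hp hp']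
  split_ifs with hn
  · refine (denseRange_toLp_trigPoly hp').induction_on f
      (isClosed_eq (by fun_prop) (by fun_prop)) fun c => ?_
    rw [rieszL_trigPoly hp hp', analyticPart, trigPoly, Finsupp.linearCombination_apply,
      Finsupp.linearCombination_apply, Finsupp.sum, Finsupp.sum]
    simp only [map_sum, map_smul]
    refine Finset.sum_congr rfl fun m _ => ?_
    split_ifs with hm
    · rfl
    · rw [coeffL_mulL_toLpT_fourier, hψ _ (by omega)]
      simp
  · rfl

end Riesz

theorem isClosed_hardySpace (p : ℝ≥0∞) [Fact (1 ≤ p)] :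
    IsClosed (hardySpace p : Set (LpT p)) := by
  have : (hardySpace p : Set (LpT p)) = ⋂ n : ℤ, ⋂ _ : n < 0, {f | coeffL p n f = 0} := by
    ext f
    simp only [Set.mem_iInter]
    rfl
  rw [this]
  exact isClosed_iInter fun n => isClosed_iInter fun _ =>
    isClosed_eq (coeffL p n).continuous continuous_const

/-- For `k ≥ 1` and `r < 1` the function `z^k F(r z)` vanishes at `0`, so its mean over the circle
is zero; dominated convergence as `r → 1` carries this to the boundary function. -/
theorem coeffL_eq_zero_of_mem_HInfty {φ : LpT ⊤} (hφ : φ ∈ HInfty) {n : ℤ} (hn : n < 0) :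
    coeffL ⊤ n φ = 0 := by
  obtain ⟨F, hF, ⟨C, hC⟩, hb⟩ := hφ
  obtain ⟨k, rfl⟩ : ∃ k : ℕ, n = -(k : ℤ) := ⟨n.natAbs, by omega⟩
  have hk : k ≠ 0 := by omega
  have hz : ∀ θ : UCircle, fourier (k : ℤ) θ = (AddCircle.toCircle θ : ℂ) ^ k := fun θ => by
    rw [fourier_apply, natCast_zsmul, AddCircle.toCircle_nsmul, Circle.coe_pow]
  have hr : ∀ᶠ r : ℝ in 𝓝[<] 1, 0 < r ∧ r < 1 := by
    filter_upwards [Ioo_mem_nhdsLT (zero_lt_one' ℝ)] with r hr using hr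
  have hball : ∀ r : ℝ, 0 < r → r < 1 → ∀ z : ℂ, ‖z‖ ≤ 1 →
      (r : ℂ) * z ∈ Metric.ball (0 : ℂ) 1 := fun r h0 h1 z hz => by
    rw [mem_ball_zero_iff, norm_mul, Complex.norm_real, Real.norm_of_nonneg h0.le]
    nlinarith [norm_nonneg z]
  have hdiff : ∀ r : ℝ, 0 < r → r < 1 →
      DifferentiableOn ℂ (fun z => z ^ k * F (r * z)) (Metric.closedBall 0 1) := by
    intro r h0 h1
    refine DifferentiableOn.mul (by fun_prop) ?_
    exact hF.comp (by fun_prop) fun z hz => hball r h0 h1 z (by simpa using hz)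
  have hlim : Tendsto (fun r : ℝ => ∫ θ : UCircle, (AddCircle.toCircle θ : ℂ) ^ k *
      F (r * (AddCircle.toCircle θ : ℂ)) ∂arc) (𝓝[<] 1)
      (𝓝 (∫ θ, (AddCircle.toCircle θ : ℂ) ^ k * φ θ ∂arc)) := by
    refine tendsto_integral_filter_of_dominated_convergence (fun _ => C) ?_ ?_
      (integrable_const C) ?_
    · filter_upwards [hr] with r h
      refine Continuous.aestronglyMeasurable ?_
      exact (hdiff r h.1 h.2).continuousOn.comp_continuous (by fun_prop) fun θ => by
        simpa using (Circle.norm_coe _).le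
    · filter_upwards [hr] with r h
      refine Eventually.of_forall fun θ => ?_
      rw [norm_mul, norm_pow, Circle.norm_coe, one_pow, one_mul]
      exact hC _ (hball r h.1 h.2 _ (Circle.norm_coe _).le)
    · filter_upwards [hb] with θ h
      exact h.const_mul _
  have hzero : Tendsto (fun r : ℝ => ∫ θ : UCircle, (AddCircle.toCircle θ : ℂ) ^ k *
      F (r * (AddCircle.toCircle θ : ℂ)) ∂arc) (𝓝[<] 1) (𝓝 0) := by
    refine tendsto_const_nhds.congr' ?_
    filter_upwards [hr] with r h
    rw [integral_comp_toCircle (f := fun z => z ^ k * F (r * z))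
      (DifferentiableOn.diffContOnCl (by
        rw [closure_ball _ one_ne_zero]; exact hdiff r h.1 h.2))]
    simp [hk]
  rw [← tendsto_nhds_unique hlim hzero]
  change ∫ θ, fourier (-(-(k : ℤ))) θ • φ θ ∂arc = _
  rw [neg_neg]
  simp only [hz, smul_eq_mul]

/-! ### Toeplitz operators and the two estimates -/

section Toeplitz

variable {p : ℝ≥0∞} [Fact (1 ≤ p)] (hp : 1 < p) (hp' : p ≠ ⊤)

/-- The Toeplitz operator as a bounded operator on `H^p`. -/
noncomputable def toeplitzL (ψ : LpT ⊤) : hardySpace p →L[ℂ] hardySpace p :=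
  ((rieszL p).comp ((mulL p ψ).comp (hardySpace p).subtypeL)).codRestrict (hardySpace p)
    fun _ => rieszL_mem hp hp' _

theorem toeplitzL_apply (ψ : LpT ⊤) (f : hardySpace p) :
    toeplitzL hp hp' ψ f = toeplitz p ψ f :=
  Subtype.ext (coe_toeplitz hp hp' ψ f).symm

include hp hp'

theorem isLeftInvertible_toeplitz {φ χ : LpT ⊤} (hφ : ∀ n < 0, coeffL ⊤ n φ = 0)
    (hχ : ∀ᵐ θ ∂arc, χ θ * φ θ = 1) : IsLeftInvertible (toeplitz p φ) := by
  refine ⟨toeplitzL hp hp' χ, fun f => ?_⟩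
  rw [toeplitzL_apply]
  apply Subtype.ext
  rw [coe_toeplitz hp hp', coe_toeplitz hp hp',
    rieszL_of_mem hp hp' (mulL_mem_hardySpace hp hp' hφ f.2), mulL_mulL_of_mul_eq_one hχ,
    rieszL_of_mem hp hp' f.2]

theorem surjective_toeplitz {ψ χ : LpT ⊤} (hψ : ∀ n, 0 < n → coeffL ⊤ n ψ = 0)
    (hχ : ∀ᵐ θ ∂arc, χ θ * ψ θ = 1) : Function.Surjective (toeplitz p ψ) := by
  intro g
  refine ⟨toeplitz p χ g, Subtype.ext ?_⟩
  rw [coe_toeplitz hp hp', coe_toeplitz hp hp', rieszL_mulL_rieszL hp hp' hψ, mulL_comm,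
    mulL_mulL_of_mul_eq_one hχ, rieszL_of_mem hp hp' g.2]

variable {q : ℝ≥0∞} [Fact (1 ≤ q)] [ENNReal.HolderConjugate p q]

theorem exists_norm_pairL_le_of_isLeftInvertible {φ : LpT ⊤} (hφ : ∀ n < 0, coeffL ⊤ n φ = 0)
    (h : IsLeftInvertible (toeplitz p φ)) :
    ∃ K : ℝ, ∀ (f : LpT q) (g : LpT p), ‖pairL q p f g‖ ≤ K * ‖f‖ * ‖mulL p φ g‖ := by
  obtain ⟨L, hL⟩ := h
  have h1 : ∀ f ∈ hardySpace p, ‖f‖ ≤ ‖L‖ * ‖mulL p φ f‖ := fun f hf => by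
    have h2 := L.le_opNorm (toeplitz p φ ⟨f, hf⟩)
    rw [hL] at h2
    rwa [Submodule.coe_norm, Submodule.coe_norm, coe_toeplitz hp hp',
      rieszL_of_mem hp hp' (mulL_mem_hardySpace hp hp' hφ hf)] at h2
  have h2 : ∀ f : LpT p, ‖f‖ ≤ ‖L‖ * ‖mulL p φ f‖ := fun f => by
    refine (denseRange_toLp_trigPoly hp').induction_on f
      (isClosed_le (by fun_prop) (by fun_prop)) fun c => ?_
    -- With `b` below all frequencies, multiplication by `e^{-ibθ}` moves the polynomial into `H^p`,
    -- preserves norms and commutes with `φ`.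
    obtain ⟨b, hb⟩ := c.support.finite_toSet.bddBelow
    have h3 : mulL p (toLpT ⊤ (fourier (-b))) (toLpT p (trigPoly c)) ∈ hardySpace p := by
      intro n hn
      rw [← coeffL_apply, coeffL_mulL_fourier, coeffL_trigPoly]
      by_contra h0
      have := hb (Finsupp.mem_support_iff.2 h0)
      omega
    have h4 := h1 _ h3
    rwa [mulL_comm, norm_mulL_fourier, norm_mulL_fourier] at h4
  refine ⟨‖L‖, fun f g => (norm_pairL_le f g).trans ?_⟩
  calc ‖f‖ * ‖g‖ ≤ ‖f‖ * (‖L‖ * ‖mulL p φ g‖) := by gcongr; exact h2 g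
    _ = _ := by ring

/-- Pairing with a trigonometric polynomial of frequencies at most `b` sees only the coefficients of
`f` of index at least `-b`. Solving `T_ψ x = P₊(e^{ibθ} f)` with norm control reproduces exactly
these coefficients in `ψ e^{-ibθ} x`, and `ψ` can then be moved to the other side of the pairing. -/
theorem exists_norm_pairL_le_of_surjective (hq : q ≠ ⊤) {ψ : LpT ⊤}
    (h : Function.Surjective (toeplitz p ψ)) :
    ∃ K : ℝ, ∀ (f : LpT p) (g : LpT q), ‖pairL p q f g‖ ≤ K * ‖f‖ * ‖mulL q ψ g‖ := by
  have : CompleteSpace (hardySpace p) := (isClosed_hardySpace p).completeSpace_coe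
  have hsurj : Function.Surjective (toeplitzL hp hp' ψ) := fun g => by
    obtain ⟨f, hf⟩ := h g
    exact ⟨f, by rw [toeplitzL_apply, hf]⟩
  -- The open mapping theorem makes the preimage bound uniform, hence independent of `b`.
  obtain ⟨C, hC, hpre⟩ := (toeplitzL hp hp' ψ).exists_preimage_norm_le hsurj
  refine ⟨C * ‖rieszL p‖, fun f g => ?_⟩
  refine (denseRange_toLp_trigPoly hq).induction_on g
    (isClosed_le (by fun_prop) (by fun_prop)) fun d => ?_
  obtain ⟨b, hb⟩ := d.support.finite_toSet.bddAbove
  obtain ⟨x, hx, hxn⟩ :=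
    hpre ⟨rieszL p (mulL p (toLpT ⊤ (fourier b)) f), rieszL_mem hp hp' _⟩
  have hx' : rieszL p (mulL p ψ x) = rieszL p (mulL p (toLpT ⊤ (fourier b)) f) := by
    rw [← coe_toeplitz hp hp', ← toeplitzL_apply hp hp', hx]
  have h1 : pairL p q f (toLpT q (trigPoly d)) =
      pairL p q (mulL p ψ (mulL p (toLpT ⊤ (fourier (-b))) x)) (toLpT q (trigPoly d)) := by
    refine pairL_trigPoly_congr fun n hn => ?_
    have h2 := congrArg (coeffL p (b - n)) hx'
    rw [coeffL_rieszL hp hp', coeffL_rieszL hp hp',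
      if_pos (sub_nonneg.2 (hb hn)), if_pos (sub_nonneg.2 (hb hn)), coeffL_mulL_fourier] at h2
    rw [mulL_comm, coeffL_mulL_fourier, sub_neg_eq_add, neg_add_eq_sub, h2,
      sub_sub_cancel_left]
  have h3 : ‖(x : LpT p)‖ ≤ C * (‖rieszL p‖ * ‖f‖) := by
    refine hxn.trans ?_
    gcongr
    refine ((rieszL p).le_opNorm _).trans ?_
    rw [norm_mulL_fourier]
  rw [h1, pairL_mulL]
  refine (norm_pairL_le _ _).trans ?_
  rw [norm_mulL_fourier]
  calc _ ≤ C * (‖rieszL p‖ * ‖f‖) * ‖mulL q ψ (toLpT q (trigPoly d))‖ := by gcongr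
    _ = _ := by ring

end Toeplitz

end HardyToeplitz

open HardyToeplitz in
theorem proposition3p1 (p : ENNReal) [Fact (1 ≤ p)] (hp : 1 < p) (hp' : p ≠ ⊤)
    (φ : LpT ⊤) (hφ : φ ∈ HInfty) :
    Function.Surjective (toeplitz p (star φ)) ↔ IsLeftInvertible (toeplitz p φ) := by
  have : Fact (1 ≤ ENNReal.conjExponent p) := ⟨ENNReal.HolderConjugate.one_le _ p⟩
  have hq : ENNReal.conjExponent p ≠ ⊤ :=
    (ENNReal.HolderConjugate.ne_top_iff_ne_one _ p).2 hp.ne'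
  have hφ0 : ∀ n < 0, coeffL ⊤ n φ = 0 := fun n hn => coeffL_eq_zero_of_mem_HInfty hφ hn
  have hstar0 : ∀ n, 0 < n → coeffL ⊤ n (star φ) = 0 := fun n hn => by
    rw [coeffL_star, hφ0 _ (by omega), star_zero]
  have hstar : ∀ {ψ χ : LpT ⊤}, (∀ᵐ θ ∂arc, χ θ * ψ θ = 1) →
      ∀ᵐ θ ∂arc, (star χ : LpT ⊤) θ * (star ψ : LpT ⊤) θ = 1 := fun {ψ χ} h => by
    filter_upwards [h, Lp.coeFn_star χ, Lp.coeFn_star ψ] with θ h1 h2 h3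
    rw [h2, h3, Pi.star_apply, Pi.star_apply, mul_comm, ← star_mul, h1, star_one]
  constructor
  · intro h
    obtain ⟨K, hK⟩ :=
      exists_norm_pairL_le_of_surjective (q := ENNReal.conjExponent p) hp hp' hq h
    obtain ⟨χ, hχ⟩ := exists_inverse_of_norm_pairL_le hp' hq hK
    refine isLeftInvertible_toeplitz hp hp' hφ0 (χ := star χ) ?_
    simpa only [star_star] using hstar hχ
  · intro h
    obtain ⟨K, hK⟩ := exists_norm_pairL_le_of_isLeftInvertible
      (q := ENNReal.conjExponent p) hp hp' hφ0 h
    obtain ⟨χ, hχ⟩ := exists_inverse_of_norm_pairL_le hq hp' hK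
    exact surjective_toeplitz hp hp' hstar0 (hstar hχ)
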